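/- A differential space is a topological space $P$ with a ring $C^\infty(P)$ of real functions such that the sets $f^{-1}((a,b))$ ($f\in C^\infty(P)$, $a,b\in\mathbb{R}$) form a sub-basis of the topology, $F(f_1,\dots,f_k)\in C^\infty(P)$ for all $f_i\in C^\infty(P)$ and $F\in C^\infty(\mathbb{R}^k)$, and every function that agrees locally with elements of $C^\infty(P)$ belongs to $C^\infty(P)$; smooth maps are those that pull smooth functions back to smooth functions. An integral curve of a derivation $X$ of $C^\infty(P)$ is a map $c$ from an interval to $P$ with $\frac{d}{dt}f(c(t))=(Xf)(c(t))$ for all $f\in C^\infty(P)$; a map from a one-point interval always counts as an integral curve. Let $P$ be a subcartesian space, that is, a Hausdorff differential space in which every point has an open neighbourhood diffeomorphic to a subset of some $\mathbb{R}^N$ with its induced differential structure. A vector field on $P$ is a derivation $X$ of $C^\infty(P)$ whose translations along integral curves form a local one-parameter group $\exp tX$ of local diffeomorphisms of $P$: every point has an open neighbourhood $U$ such that, for all sufficiently small $|t|$, $\exp tX$ is defined on $U$ and restricts to a diffeomorphism of $U$ onto an open subset of $P$. The orbit through $p\in P$ of the family of all vector fields on $P$ is the set of all points $(\exp t_1X_1\circ\cdots\circ\exp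 t_nX_n)(p)$ that are defined, where $n\ge 0$, $t_i\in\mathbb{R}$ and $X_1,\dots,X_n$ are vector fields on $P$. The orbits are smoothly included manifolds, with smooth structure determined by the maps $(t_1,\dots,t_n)\mapsto(\exp t_1X_1\circ\cdots\circ\exp t_nX_n)(y)$, and they partition $P$. The tangent space $T_yO$ of an orbit $O$ at $y\in O$ is regarded as a subspace of $T_yP$, the space of derivations of $C^\infty(P)$ at $y$. Then the partition of $P$ into orbits satisfies Whitney's condition A: let $O$ and $O'$ be orbits, let $(x_n)$ be a sequence of points of $O$ converging in $P$ to a point $x\in O'$, let $U$ be an open neighbourhood of $x$ in $P$ and $\varphi$ a diffeomorphism of $U$ onto a subset of $\mathbb{R}^N$, and use the differential of $\varphi$ to identify the spaces $T_yP$, $y\in U$, with subspaces of $\mathbb{R}^N$. If the spaces $T_{x_n}O$ (for those $n$ with $x_n\in U$, hence for all large $n$) converge to $D$ in the Grassmannian of $m$-planes in $\mathbb{R}^N$, $m=\dim O$, then $T_xO'\subseteq D$. -/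

import Mathlib

open scoped ContDiff Topology
open Filter

/-- A differential structure on a topological space `P`: a ring `C^∞(P)` of real functions on `P`
such that the sets `f⁻¹(a, b)` form a sub-basis of the topology, `C^∞(P)` is closed under
composition with smooth functions of finitely many real variables, and every function which locally
agrees with elements of `C^∞(P)` belongs to `C^∞(P)`. -/
class DifferentialSpace (P : Type*) [t : TopologicalSpace P] where
  /-- The ring `C^∞(P)`. -/
  smooth : Subalgebra ℝ (P → ℝ)
  subbasis : t = TopologicalSpace.generateFrom
    {V : Set P | ∃ f ∈ smooth, ∃ a b : ℝ, V = f ⁻¹' Set.Ioo a b}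
  comp_mem : ∀ (k : ℕ) (f : Fin k → P → ℝ), (∀ i, f i ∈ smooth) →
    ∀ F : (Fin k → ℝ) → ℝ, ContDiff ℝ ∞ F → (fun x => F (fun i => f i x)) ∈ smooth
  of_locally : ∀ f : P → ℝ,
    (∀ x, ∃ U : Set P, IsOpen U ∧ x ∈ U ∧ ∃ g ∈ smooth, Set.EqOn f g U) → f ∈ smooth

namespace DifferentialSpace

/-- The standard differential structure of `ℝ^N`. -/
instance euclidean (N : ℕ) : DifferentialSpace (EuclideanSpace ℝ (Fin N)) where
  smooth :=
    { carrier := {f | ContDiff ℝ ∞ f}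
      mul_mem' := by
        intro f g (hf : ContDiff ℝ ∞ f) (hg : ContDiff ℝ ∞ g)
        exact (hf.mul hg : ContDiff ℝ ∞ fun x => f x * g x)
      add_mem' := by
        intro f g (hf : ContDiff ℝ ∞ f) (hg : ContDiff ℝ ∞ g)
        exact (hf.add hg : ContDiff ℝ ∞ fun x => f x + g x)
      algebraMap_mem' := fun r => (contDiff_const : ContDiff ℝ ∞ fun _ => r) }
  subbasis := by
    apply le_antisymm
    · apply le_generateFrom
      rintro V ⟨f, hf, a, b, rfl⟩
      exact isOpen_Ioo.preimage (ContDiff.continuous (𝕜 := ℝ) (n := ∞) hf)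
    · intro V hV
      refine (@isOpen_iff_forall_mem_open _ (TopologicalSpace.generateFrom _) V).2 fun x hx => ?_
      obtain ⟨r, hr, hrV⟩ := Metric.isOpen_iff.1 hV x hx
      refine ⟨(fun y => ‖y - x‖ ^ 2) ⁻¹' Set.Ioo (-1) (r ^ 2), ?_, ?_, ?_⟩
      · intro y hy
        apply hrV
        rw [Metric.mem_ball, dist_eq_norm]
        exact lt_of_pow_lt_pow_left₀ 2 hr.le hy.2
      · refine TopologicalSpace.isOpen_generateFrom_of_mem
          ⟨_, ((contDiff_id.sub contDiff_const).norm_sq ℝ : ContDiff ℝ ∞ _), _, _, rfl⟩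
      · simp [hr]
  comp_mem := fun _ _ hf _ hF => hF.comp (contDiff_pi.2 hf)
  of_locally := by
    intro f hf
    change ContDiff ℝ ∞ f
    refine contDiff_iff_contDiffAt.2 fun x => ?_
    obtain ⟨U, hU, hx, g, hg, hfg⟩ := hf x
    exact (ContDiff.contDiffAt (𝕜 := ℝ) (n := ∞) hg).congr_of_eventuallyEq
      (Filter.eventuallyEq_of_mem (hU.mem_nhds hx) hfg)

variable {P : Type*} [TopologicalSpace P] [DifferentialSpace P]
variable {Q : Type*} [TopologicalSpace Q] [DifferentialSpace Q]

variable (P) in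
/-- The ring `C^∞(P)` as a type. -/
abbrev SmoothFun : Type _ := ↥(DifferentialSpace.smooth (P := P))

/-- `f` restricts to a smooth function on the differential subspace `S` of `P`: near every point of
`S` it agrees on `S` with an element of `C^∞(P)`. -/
def SmoothFunOn (S : Set P) (f : P → ℝ) : Prop :=
  ∀ x ∈ S, ∃ V : Set P, IsOpen V ∧ x ∈ V ∧ ∃ g ∈ smooth (P := P), Set.EqOn f g (S ∩ V)

/-- `φ` restricts to a smooth map from the differential subspace `S` of `P` to `Q`: it pulls
smooth functions back to smooth functions. (Continuity on `S` is a consequence.) -/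
def SmoothMapOn (S : Set P) (φ : P → Q) : Prop :=
  ∀ g ∈ smooth (P := Q), SmoothFunOn S (g ∘ φ)

/-- `φ` restricts to a diffeomorphism from the differential subspace `S` of `P` onto the
differential subspace `φ(S)` of `Q`. -/
def IsDiffeoOn (S : Set P) (φ : P → Q) : Prop :=
  SmoothMapOn S φ ∧ ∃ ψ : Q → P, Set.LeftInvOn ψ φ S ∧ SmoothMapOn (φ '' S) ψ

/-- `φ` is a diffeomorphism from the open subset `U` of `P` onto a subset of `ℝ^N`. -/
def IsLocalChart {N : ℕ} (U : Set P) (φ : P → EuclideanSpace ℝ (Fin N)) : Prop :=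
  IsOpen U ∧ IsDiffeoOn U φ

/-- The tangent space `T_p P`: all derivations of `C^∞(P)` at `p`. -/
def tangentSpace (p : P) : Submodule ℝ (Module.Dual ℝ (SmoothFun P)) where
  carrier := {u | ∀ f g : SmoothFun P, u (f * g) = f.1 p * u g + u f * g.1 p}
  add_mem' := by
    intro u v hu hv f g
    simp only [LinearMap.add_apply, hu f g, hv f g]
    ring
  zero_mem' := by
    intro f g
    simp
  smul_mem' := by
    intro r u hu f g
    simp only [LinearMap.smul_apply, smul_eq_mul, hu f g]
    ring

/-- `c` is an integral curve on `I` of the derivation `X` of `C^∞(P)`: for all `f ∈ C^∞(P)` and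
`t ∈ I`, `d/dt f(c(t)) = (X f)(c(t))`. (Smoothness of `c` on `I` is a consequence when `I` is an
interval with non-empty interior. When `I` is one point, every map is an integral curve.) -/
def IsIntegralCurve (X : Derivation ℝ (SmoothFun P) (SmoothFun P)) (c : ℝ → P) (I : Set ℝ) :
    Prop :=
  ∀ f : SmoothFun P, ∀ t ∈ I, HasDerivWithinAt (fun s => f.1 (c s)) ((X f).1 (c t)) I t

/-- The partially defined map `exp(tX)`: it is defined at `x` if there is an integral curve of `X`
starting at `x` at time `0` and reaching time `t`, and its value is then the point reached at
time `t`. -/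
noncomputable def exp (X : Derivation ℝ (SmoothFun P) (SmoothFun P)) (t : ℝ) : P →. P := fun x =>
  ⟨∃ c : ℝ → P, IsIntegralCurve X c (Set.uIcc 0 t) ∧ c 0 = x, fun h => h.choose t⟩

/-- The derivation `X` is a vector field: translations along its integral curves form a local
one-parameter group of local diffeomorphisms. That is, every point has an open neighbourhood `U`
such that for all sufficiently small `|t|` the map `exp(tX)` is defined on `U` and restricts to a
diffeomorphism of `U` onto an open subset of `P`. -/
def IsVectorField (X : Derivation ℝ (SmoothFun P) (SmoothFun P)) : Prop :=
  ∀ x : P, ∃ U : Set P, IsOpen U ∧ x ∈ U ∧ ∃ ε : ℝ, 0 < ε ∧ ∀ t : ℝ, |t| < ε →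
    ∃ Φ : P → P, (∀ y ∈ U, Φ y ∈ exp X t y) ∧ IsOpen (Φ '' U) ∧ IsDiffeoOn U Φ

variable (P) in
/-- The family of all vector fields on `P`. -/
abbrev VectorField : Type _ :=
  {X : Derivation ℝ (SmoothFun P) (SmoothFun P) // IsVectorField X}

/-- The partially defined map `exp(t₁X₁) ∘ ⋯ ∘ exp(tₙXₙ)`. -/
noncomputable def multiExp : {n : ℕ} → (Fin n → VectorField P) → (Fin n → ℝ) → P →. P
  | 0, _, _ => fun x => Part.some x
  | _ + 1, X, t => fun x => (multiExp (Fin.tail X) (Fin.tail t) x).bind (exp (X 0).1 (t 0))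

/-- The orbit through `p` of the family of all vector fields on `P`. -/
def orbit (p : P) : Set P :=
  {y | ∃ (n : ℕ) (X : Fin n → VectorField P) (t : Fin n → ℝ), y ∈ multiExp X t p}

/-- The smooth structure of the orbit manifold. The charts of an orbit are inverses of maps
`(t₁, …, tₙ) ↦ (exp(t₁X₁) ∘ ⋯ ∘ exp(tₙXₙ))(y)` with `y` in the orbit, and all these maps are smooth
on their open domains; so the smooth maps from Cartesian spaces to the orbit are those of the
diffeology generated by the compositions of these maps with smooth maps into their domains. -/
instance orbitDiffeology (p : P) : DiffeologicalSpace (orbit p) :=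
  DiffeologicalSpace.generateFrom
    {q | ∃ (n : ℕ) (X : Fin n → VectorField P) (y : orbit p)
      (g : EuclideanSpace ℝ (Fin q.1) → (Fin n → ℝ)),
      ContDiff ℝ ∞ g ∧ ∀ s, (q.2 s : P) ∈ multiExp X (g s) y}

/-- The tangent space `T_x O ⊆ T_x P` at `x` of the orbit `O` through `p`: it consists of the
velocities at `x` of curves which are smooth for the smooth structure of the orbit. -/
def orbitTangentSpace (p : P) (x : orbit p) : Submodule ℝ (tangentSpace (x : P)) :=
  Submodule.span ℝ {u | ∃ c : ℝ → orbit p, Diffeology.DSmooth c ∧ c 0 = x ∧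
    ∀ f : SmoothFun P, HasDerivAt (fun s => f.1 (c s : P)) (u.1 f) 0}

/-- The subspace of `ℝ^N` identified with a subspace `W` of `T_x P` by means of the differential
at `x` of a map `φ = (φ₁, …, φ_N)` into `ℝ^N` which is smooth near `x`: a derivation `u` at `x` is
sent to `(u(φ₁), …, u(φ_N))`, where `u` is evaluated on any element of `C^∞(P)` that agrees
with `φᵢ` near `x`. -/
def chartImage {N : ℕ} (φ : P → EuclideanSpace ℝ (Fin N)) (x : P)
    (W : Submodule ℝ (tangentSpace x)) : Submodule ℝ (EuclideanSpace ℝ (Fin N)) where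
  carrier := {w | ∃ u ∈ W, ∀ (i : Fin N) (g : SmoothFun P),
    (g.1 =ᶠ[𝓝 x] fun y => φ y i) → w i = u.1 g}
  add_mem' := by
    rintro w w' ⟨u, hu, h⟩ ⟨u', hu', h'⟩
    exact ⟨u + u', W.add_mem hu hu', fun i g hg => by simp [h i g hg, h' i g hg]⟩
  zero_mem' := ⟨0, W.zero_mem, fun i g _ => by simp⟩
  smul_mem' := by
    rintro r w ⟨u, hu, h⟩
    exact ⟨r • u, W.smul_mem r hu, fun i g hg => by simp [h i g hg]⟩

/-- Convergence of linear subspaces of `ℝ^N` in the Grassmannian: the orthogonal projections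
converge. (In particular the dimensions are eventually equal to that of the limit.) -/
def GrassmannTendsto {N : ℕ} (T : ℕ → Submodule ℝ (EuclideanSpace ℝ (Fin N)))
    (D : Submodule ℝ (EuclideanSpace ℝ (Fin N))) : Prop :=
  Tendsto (fun n => (T n).starProjection) atTop (𝓝 D.starProjection)

end DifferentialSpace

/-- A subcartesian space: a Hausdorff differential space which is locally diffeomorphic to subsets
of Cartesian spaces. -/
class SubcartesianSpace (P : Type*) [TopologicalSpace P] [DifferentialSpace P] : Prop
    extends T2Space P where
  exists_chart : ∀ x : P, ∃ (N : ℕ) (U : Set P) (φ : P → EuclideanSpace ℝ (Fin N)),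
    x ∈ U ∧ DifferentialSpace.IsLocalChart U φ

/-!
Whitney's condition A for orbits holds because every vector tangent to an orbit `O'` at `x` extends
to a section, continuous at `x` and defined on a neighbourhood of `x` in `P`, of the tangent spaces
of *all* orbits. Along a sequence `xₙ → x` in `O` the values of this section, written in the chart
`φ`, lie in `T_{xₙ}O` and converge to the given vector, which therefore lies in the limit `D` of the
spaces `T_{xₙ}O`.

To construct the section (`exists_extendableVelocity`), let a curve in `O'` be given by
`s ↦ (exp(t₁X₁) ∘ ⋯ ∘ exp(tₙXₙ))(q)` with times depending smoothly on `s`; by the definition of the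
orbit diffeology all smooth curves are locally of this form (`exists_multiExp_of_isPlot`). By the
chain rule its velocity is a linear combination of push-forwards of the vectors `Xᵢ` by the local
diffeomorphisms `exp(t₁X₁) ∘ ⋯ ∘ exp(tᵢ₋₁Xᵢ₋₁)`. The values of a vector field `X` form a continuous
section, and so do their push-forwards, because they are the velocities of curves obtained by
letting first `X` and then the other fields flow for fixed times; these curves stay in one orbit.

This uses the following facts on the partial maps `exp(tX)`. Integral curves are unique
(`IsIntegralCurve.eqOn_Icc`), as they solve ordinary differential equations with smooth right-hand
sides in local coordinates; hence the group law `Flow.add`. Wherever `exp(tX)` is defined, it is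
defined and smooth nearby, for large `|t|` too (`Flow.hasLocalFlow`). Smooth dependence of solutions
on parameters is not needed: `hasDerivAt_flow` follows from the smoothness of `exp(tX)` for fixed
`t`, which is part of the definition of a vector field, and from the continuity of the flow at time
zero (`exists_flow_subset`).
-/

namespace DifferentialSpace

/-! ### Topology and coordinates of differential spaces -/

section

variable {P : Type*} [TopologicalSpace P] [DifferentialSpace P]

theorem isOpen_preimage_Ioo (f : SmoothFun P) (a b : ℝ) : IsOpen (f.1 ⁻¹' Set.Ioo a b) :=
  (DifferentialSpace.subbasis (P := P)).le _
    (TopologicalSpace.isOpen_generateFrom_of_mem ⟨f.1, f.2, a, b, rfl⟩)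

theorem continuous_smoothFun (f : SmoothFun P) : Continuous f.1 := by
  refine continuous_iff_continuousAt.2 fun x => Metric.tendsto_nhds.2 fun ε hε => ?_
  filter_upwards [(isOpen_preimage_Ioo f (f.1 x - ε) (f.1 x + ε)).mem_nhds
    ⟨by linarith, by linarith⟩] with y hy
  rw [Real.dist_eq, abs_lt]
  exact ⟨by linarith [hy.1], by linarith [hy.2]⟩

/-- The topology of a differential space is the initial topology for its smooth functions. -/
theorem tendsto_nhds_iff {α : Type*} {l : Filter α} {c : α → P} {x : P} :
    Tendsto c l (𝓝 x) ↔ ∀ f : SmoothFun P, Tendsto (fun a => f.1 (c a)) l (𝓝 (f.1 x)) := by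
  refine ⟨fun h f => ((continuous_smoothFun f).tendsto x).comp h, fun h => ?_⟩
  have hn := congrArg (fun t => @nhds P t x) (DifferentialSpace.subbasis (P := P))
  rw [hn, TopologicalSpace.tendsto_nhds_generateFrom_iff]
  rintro _ ⟨f, hf, a, b, rfl⟩ hx
  exact h ⟨f, hf⟩ (Ioo_mem_nhds hx.1 hx.2)

theorem comp_mem_smooth (f : SmoothFun P) {F : ℝ → ℝ} (hF : ContDiff ℝ ∞ F) :
    (fun x => F (f.1 x)) ∈ smooth (P := P) :=
  comp_mem 1 (fun _ => f.1) (fun _ => f.2) (fun v => F (v 0)) (hF.comp (contDiff_apply ℝ ℝ 0))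

/-- Smooth functions separate points from closed sets, in the strong sense that bump functions
exist. This is where the sub-basis axiom and closure under smooth compositions are used. -/
theorem exists_bump {U : Set P} (hU : IsOpen U) : ∀ x ∈ U, ∃ χ : SmoothFun P,
    (∀ᶠ y in 𝓝 x, χ.1 y = 1) ∧ ∀ y ∉ U, ∀ᶠ y' in 𝓝 y, χ.1 y' = 0 := by
  have hg := (DifferentialSpace.subbasis (P := P)).ge U hU
  induction hg with
  | basic s hs =>
    obtain ⟨f, hf, a, b, rfl⟩ := hs
    intro x hx
    obtain ⟨r, hr, hrs⟩ := Metric.nhds_basis_closedBall.mem_iff.1 (Ioo_mem_nhds hx.1 hx.2)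
    let B : ContDiffBump (f x) := ⟨r / 2, r, by positivity, by linarith⟩
    refine ⟨⟨_, comp_mem_smooth ⟨f, hf⟩ (B.contDiff (n := ⊤))⟩, ?_, fun y hy => ?_⟩
    · exact ((continuous_smoothFun ⟨f, hf⟩).tendsto x).eventually B.eventuallyEq_one
    · refine ((continuous_smoothFun ⟨f, hf⟩).tendsto y).eventually
        (p := fun t => B t = 0) ?_
      have : f y ∉ tsupport B := fun h => hy (hrs (B.tsupport_eq ▸ h))
      exact notMem_tsupport_iff_eventuallyEq.1 this
  | univ => exact fun x _ => ⟨1, Eventually.of_forall fun _ => rfl, fun y hy => (hy trivial).elim⟩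
  | inter s t hs ht ihs iht =>
    intro x hx
    obtain ⟨χ, h1, h0⟩ := ihs ((DifferentialSpace.subbasis (P := P)).le s hs) x hx.1
    obtain ⟨χ', h1', h0'⟩ := iht ((DifferentialSpace.subbasis (P := P)).le t ht) x hx.2
    refine ⟨χ * χ', ?_, fun y hy => ?_⟩
    · filter_upwards [h1, h1'] with y hy hy'
      simp [hy, hy']
    · by_cases hys : y ∈ s
      · filter_upwards [h0' y fun h => hy ⟨hys, h⟩] with y' hy'
        simp [hy']
      · filter_upwards [h0 y hys] with y' hy'
        simp [hy']
  | sUnion S hS ih =>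
    rintro x ⟨s, hs, hxs⟩
    obtain ⟨χ, h1, h0⟩ := ih s hs ((DifferentialSpace.subbasis (P := P)).le s (hS s hs)) x hxs
    exact ⟨χ, h1, fun y hy => h0 y fun h => hy ⟨s, hs, h⟩⟩

/-- A smooth map defined on a differential subspace is continuous on it. -/
theorem SmoothMapOn.continuousOn {Q : Type*} [TopologicalSpace Q] [DifferentialSpace Q]
    {S : Set P} {φ : P → Q} (h : SmoothMapOn S φ) : ContinuousOn φ S := by
  intro x hx
  refine tendsto_nhds_iff.2 fun f => ?_
  obtain ⟨V, hV, hxV, g, hg, hfg⟩ := h f.1 f.2 x hx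
  have hc : Tendsto g (𝓝[S] x) (𝓝 (f.1 (φ x))) := by
    have := (continuous_smoothFun ⟨g, hg⟩).continuousWithinAt (s := S) (x := x)
    rw [ContinuousWithinAt] at this
    rwa [show f.1 (φ x) = g x from hfg ⟨hx, hxV⟩]
  refine hc.congr' ?_
  filter_upwards [self_mem_nhdsWithin, mem_nhdsWithin_of_mem_nhds (hV.mem_nhds hxV)] with y hy hyV
  exact (hfg ⟨hy, hyV⟩).symm

theorem SmoothFunOn.exists_eventuallyEq {S : Set P} (hS : IsOpen S) {f : P → ℝ}
    (h : SmoothFunOn S f) {x : P} (hx : x ∈ S) : ∃ g : SmoothFun P, f =ᶠ[𝓝 x] g.1 := by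
  obtain ⟨V, hV, hxV, g, hg, hfg⟩ := h x hx
  exact ⟨⟨g, hg⟩, mem_of_superset ((hS.inter hV).mem_nhds ⟨hx, hxV⟩) hfg⟩

theorem IsLocalChart.exists_component {N : ℕ} {U : Set P} {φ : P → EuclideanSpace ℝ (Fin N)}
    (h : IsLocalChart U φ) {x : P} (hx : x ∈ U) (i : Fin N) :
    ∃ g : SmoothFun P, (fun y => φ y i) =ᶠ[𝓝 x] g.1 := by
  refine SmoothFunOn.exists_eventuallyEq h.1 (h.2.1 (fun v => v i) ?_) hx
  change ContDiff ℝ ∞ fun v : EuclideanSpace ℝ (Fin N) => v i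
  exact (EuclideanSpace.proj (𝕜 := ℝ) i).contDiff

/-- The map to `ℝ^ι` given by finitely many smooth functions. -/
def coordMap {ι : Type*} (ψ : ι → SmoothFun P) (y : P) (i : ι) : ℝ := (ψ i).1 y

theorem continuous_coordMap {ι : Type*} (ψ : ι → SmoothFun P) : Continuous (coordMap ψ) :=
  continuous_pi fun i => continuous_smoothFun (ψ i)

/-- Around each point of a subcartesian space there are finitely many *globally defined* smooth
functions which separate points near `z`, control all neighbourhoods of `z`, and through which all
germs of smooth functions at `z` factor. They are the components of a chart, cut off by a bump
function, together with that bump function. -/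
theorem exists_coordinates [SubcartesianSpace P] (z : P) :
    ∃ (ι : Type) (_ : Fintype ι) (ψ : ι → SmoothFun P),
      (∀ V ∈ 𝓝 z, ∃ r > 0, ∀ y, ‖coordMap ψ y - coordMap ψ z‖ < r → y ∈ V) ∧
      (∃ W ∈ 𝓝 z, Set.InjOn (coordMap ψ) W) ∧
      ∀ f : SmoothFun P, ∃ F : (ι → ℝ) → ℝ, ContDiff ℝ ∞ F ∧
        ∀ᶠ y in 𝓝 z, f.1 y = F (coordMap ψ y) := by
  obtain ⟨N, U, φ, hz, hφ⟩ := SubcartesianSpace.exists_chart z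
  choose g hg using fun i => hφ.exists_component hz i
  obtain ⟨U₁, hU₁s, hU₁, hzU₁⟩ := mem_nhds_iff.1
    (inter_mem (hφ.1.mem_nhds hz) (eventually_all.2 hg))
  obtain ⟨χ, hχ1, hχ0⟩ := exists_bump hU₁ z hzU₁
  obtain ⟨-, θ, hθ, hθs⟩ := hφ.2
  have hφg : ∀ y ∈ U₁, φ y = WithLp.toLp 2 fun i => (g i).1 y := fun y hy => by
    ext i
    exact (hU₁s hy).2 i
  have hθφ : ∀ y ∈ U₁, θ (WithLp.toLp 2 fun i => (g i).1 y) = y := fun y hy => by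
    rw [← hφg y hy, hθ (hU₁s hy).1]
  let ψ : Option (Fin N) → SmoothFun P := fun o => o.elim χ g
  let pr : (Option (Fin N) → ℝ) → EuclideanSpace ℝ (Fin N) :=
    fun v => WithLp.toLp 2 fun i => v (some i)
  have hpr : ContDiff ℝ ∞ pr := by
    refine (PiLp.contDiff_toLp (p := 2)).comp ?_
    exact contDiff_pi.2 fun i => contDiff_apply ℝ ℝ (some i)
  have hprψ : ∀ y, pr (coordMap ψ y) = WithLp.toLp 2 fun i => (g i).1 y := fun y => rfl
  have hprφ : ∀ y ∈ U₁, pr (coordMap ψ y) = φ y := fun y hy => (hφg y hy).symm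
  refine ⟨Option (Fin N), inferInstance, ψ, fun V hV => ?_, ⟨U₁, hU₁.mem_nhds hzU₁, ?_⟩,
    fun f => ?_⟩
  · have hθc : Tendsto θ (𝓝[φ '' U] (φ z)) (𝓝 z) := by
      have := hθs.continuousOn (φ z) ⟨z, hz, rfl⟩
      rwa [ContinuousWithinAt, hθ hz] at this
    obtain ⟨V', hV', hzV', hVV⟩ := mem_nhdsWithin.1 (hθc hV)
    have hT : pr ⁻¹' V' ∈ 𝓝 (coordMap ψ z) := by
      refine hpr.continuous.continuousAt.preimage_mem_nhds ?_
      rw [hprφ z hzU₁]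
      exact hV'.mem_nhds hzV'
    -- The bump function vanishes outside `U₁`, so points with coordinates close to those of `z`
    -- lie in `U₁`, even though the coordinates are defined on all of `P`.
    have hT' : {v : Option (Fin N) → ℝ | v none ≠ 0} ∈ 𝓝 (coordMap ψ z) := by
      refine (continuous_apply none).continuousAt.eventually_ne ?_
      change χ.1 z ≠ 0
      rw [hχ1.self_of_nhds]
      exact one_ne_zero
    obtain ⟨r, hr, hrs⟩ := Metric.mem_nhds_iff.1 (inter_mem hT hT')
    refine ⟨r, hr, fun y hy => ?_⟩
    obtain ⟨h1, h2⟩ := hrs (mem_ball_iff_norm.2 hy)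
    have hyU : y ∈ U₁ := by
      by_contra hyU
      exact h2 (hχ0 y hyU).self_of_nhds
    have := hVV ⟨h1, hprφ y hyU ▸ ⟨y, (hU₁s hyU).1, rfl⟩⟩
    rwa [Set.mem_preimage, hprψ, hθφ y hyU] at this
  · intro y hy y' hy' h
    rw [← hθφ y hy, ← hθφ y' hy', ← hprψ, ← hprψ, h]
  · obtain ⟨V, hV, hzV, G, hG, hfG⟩ := hθs f.1 f.2 (φ z) ⟨z, hz, rfl⟩
    have hG' : ContDiff ℝ ∞ G := hG
    refine ⟨fun v => G (pr v), hG'.comp hpr, ?_⟩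
    have hV' : ∀ᶠ y in 𝓝 z, pr (coordMap ψ y) ∈ V := by
      refine (hpr.continuous.comp (continuous_coordMap ψ)).continuousAt.eventually
        (p := fun v => v ∈ V) ?_
      change V ∈ 𝓝 (pr (coordMap ψ z))
      rw [hprφ z hzU₁]
      exact hV.mem_nhds hzV
    filter_upwards [hU₁.mem_nhds hzU₁, hV'] with y hy hyV
    have := hfG ⟨hprφ y hy ▸ ⟨y, (hU₁s hy).1, rfl⟩, hyV⟩
    rw [← this, hprψ, Function.comp_apply, hθφ y hy]

end

/-! ### Uniqueness of integral curves and the group law -/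

section

variable {P : Type*} [TopologicalSpace P] [DifferentialSpace P]
variable {X : Derivation ℝ (SmoothFun P) (SmoothFun P)} {c : ℝ → P} {I J : Set ℝ}

theorem IsIntegralCurve.mono (h : IsIntegralCurve X c I) (hJ : J ⊆ I) : IsIntegralCurve X c J :=
  fun f t ht => (h f t (hJ ht)).mono hJ

theorem IsIntegralCurve.continuousOn (h : IsIntegralCurve X c I) : ContinuousOn c I :=
  fun t ht => tendsto_nhds_iff.2 fun f => (h f t ht).continuousWithinAt

theorem IsIntegralCurve.comp_add (h : IsIntegralCurve X c I) (a : ℝ) :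
    IsIntegralCurve X (fun s => c (a + s)) ((fun s => a + s) ⁻¹' I) := by
  intro f t ht
  refine ((h f (a + t) ht).comp t ((hasDerivAt_id t).const_add a).hasDerivWithinAt
    (Set.mapsTo_preimage _ I)).congr_deriv ?_
  simp

theorem IsIntegralCurve.comp_neg (h : IsIntegralCurve X c I) :
    IsIntegralCurve (-X) (fun s => c (-s)) ((fun s => -s) ⁻¹' I) := by
  intro f t ht
  refine ((h f (-t) ht).comp t (hasDerivAt_neg t).hasDerivWithinAt
    (Set.mapsTo_preimage _ I)).congr_deriv ?_
  simp

theorem IsIntegralCurve.hasDerivWithinAt_coordMap {ι : Type*} [Fintype ι]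
    (h : IsIntegralCurve X c I) (ψ : ι → SmoothFun P) {t : ℝ} (ht : t ∈ I) :
    HasDerivWithinAt (fun s => coordMap ψ (c s)) (coordMap (fun i => X (ψ i)) (c t)) I t :=
  hasDerivWithinAt_pi.2 fun i => h (ψ i) t ht

theorem Icc_mem_nhdsGE_of_mem_Ico {a b s : ℝ} (hs : s ∈ Set.Ico a b) : Set.Icc a b ∈ 𝓝[≥] s :=
  mem_of_superset (Icc_mem_nhdsGE hs.2) (Set.Icc_subset_Icc_left hs.1)

/-- Two integral curves which agree at some time agree shortly afterwards: in coordinates they solve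
the same ordinary differential equation with smooth right-hand side. -/
theorem IsIntegralCurve.eventually_eq_right [SubcartesianSpace P] {c₁ c₂ : ℝ → P} {a b s : ℝ}
    (h₁ : IsIntegralCurve X c₁ (Set.Icc a b)) (h₂ : IsIntegralCurve X c₂ (Set.Icc a b))
    (hs : s ∈ Set.Ico a b) (h : c₁ s = c₂ s) : ∀ᶠ s' in 𝓝[≥] s, c₁ s' = c₂ s' := by
  obtain ⟨ι, _, ψ, -, ⟨W, hW, hinj⟩, hrep⟩ := exists_coordinates (c₁ s)
  choose F hF hFX using fun i => hrep (X (ψ i))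
  let v : (ι → ℝ) → ι → ℝ := fun w i => F i w
  have hv : ContDiff ℝ ∞ v := contDiff_pi.2 hF
  obtain ⟨K, T, hT, hK⟩ :=
    (hv.contDiffAt (x := coordMap ψ (c₁ s)) |>.of_le (m := 1) (by simp)).exists_lipschitzOnWith
  -- On `G` the equation reads `(ψ ∘ c)' = v (ψ ∘ c)`, with `v` Lipschitz and `ψ` injective.
  let G : Set P := {y | y ∈ W ∧ coordMap (fun i => X (ψ i)) y = v (coordMap ψ y) ∧
    coordMap ψ y ∈ T}
  have hG : G ∈ 𝓝 (c₁ s) := by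
    filter_upwards [hW, eventually_all.2 hFX,
      (continuous_coordMap ψ).continuousAt.preimage_mem_nhds hT] with y h1 h2 h3
    exact ⟨h1, funext h2, h3⟩
  have hle : 𝓝[≥] s ≤ 𝓝[Set.Icc a b] s :=
    nhdsWithin_le_of_mem (Icc_mem_nhdsGE_of_mem_Ico hs)
  have hG₁ : ∀ᶠ s' in 𝓝[≥] s, c₁ s' ∈ G :=
    (h₁.continuousOn s ⟨hs.1, hs.2.le⟩).mono_left hle hG
  have hG₂ : ∀ᶠ s' in 𝓝[≥] s, c₂ s' ∈ G :=
    (h₂.continuousOn s ⟨hs.1, hs.2.le⟩).mono_left hle (h ▸ hG)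
  obtain ⟨u, hu, hus⟩ := mem_nhdsGE_iff_exists_Icc_subset.1
    (inter_mem (inter_mem hG₁ hG₂) (Icc_mem_nhdsGE_of_mem_Ico hs))
  have key : ∀ c : ℝ → P, IsIntegralCurve X c (Set.Icc a b) → (∀ r ∈ Set.Icc s u, c r ∈ G) →
      ContinuousOn (fun r => coordMap ψ (c r)) (Set.Icc s u) ∧
      (∀ r ∈ Set.Ico s u,
        HasDerivWithinAt (fun r => coordMap ψ (c r)) (v (coordMap ψ (c r))) (Set.Ici r) r) ∧
      ∀ r ∈ Set.Ico s u, coordMap ψ (c r) ∈ T := by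
    intro c hc hcG
    refine ⟨(continuous_coordMap ψ).comp_continuousOn
      (hc.continuousOn.mono fun r hr => (hus hr).2), fun r hr => ?_,
      fun r hr => (hcG r (Set.Ico_subset_Icc_self hr)).2.2⟩
    have hr' := Set.Ico_subset_Icc_self hr
    rw [← (hcG r hr').2.1]
    have hsub : Set.Icc s u ⊆ Set.Icc a b := fun r hr => (hus hr).2
    exact ((hc.hasDerivWithinAt_coordMap ψ (hus hr').2).mono hsub).mono_of_mem_nhdsWithin
      (Icc_mem_nhdsGE_of_mem_Ico hr)
  obtain ⟨k1, k2, k3⟩ := key c₁ h₁ fun r hr => (hus hr).1.1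
  obtain ⟨l1, l2, l3⟩ := key c₂ h₂ fun r hr => (hus hr).1.2
  have := ODE_solution_unique_of_mem_Icc_right (v := fun _ => v) (s := fun _ => T)
    (fun _ _ => hK) k1 k2 k3 l1 l2 l3 (by simp only [h])
  filter_upwards [Icc_mem_nhdsGE hu] with r hr
  exact hinj (hus hr).1.1.1 (hus hr).1.2.1 (this hr)

theorem IsIntegralCurve.eqOn_Icc [SubcartesianSpace P] {c₁ c₂ : ℝ → P} {a b : ℝ}
    (h₁ : IsIntegralCurve X c₁ (Set.Icc a b)) (h₂ : IsIntegralCurve X c₂ (Set.Icc a b))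
    (h : c₁ a = c₂ a) : Set.EqOn c₁ c₂ (Set.Icc a b) := by
  refine IsClosed.Icc_subset_of_forall_mem_nhdsWithin (s := {s | c₁ s = c₂ s}) ?_ h ?_
  · have := (h₁.continuousOn.prodMk h₂.continuousOn).preimage_isClosed_of_isClosed isClosed_Icc
      (isClosed_diagonal (X := P))
    rwa [Set.inter_comm] at this
  · rintro s ⟨hs, hsI⟩
    exact nhdsWithin_mono s Set.Ioi_subset_Ici_self (h₁.eventually_eq_right h₂ hsI hs)

/-- `Flow X t x y`: an integral curve of `X` leads from `x` to `y` in time `t`. -/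
def Flow (X : Derivation ℝ (SmoothFun P) (SmoothFun P)) (t : ℝ) (x y : P) : Prop :=
  ∃ c : ℝ → P, IsIntegralCurve X c (Set.uIcc 0 t) ∧ c 0 = x ∧ c t = y

theorem Flow.neg {t : ℝ} {x y : P} (h : Flow X t x y) : Flow (-X) (-t) x y := by
  obtain ⟨c, hc, h0, ht⟩ := h
  refine ⟨fun s => c (-s), hc.comp_neg.mono fun s hs => ?_, by simpa using h0, by simpa using ht⟩
  rw [Set.mem_uIcc] at hs
  rw [Set.mem_preimage, Set.mem_uIcc]
  rcases hs with hs | hs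
  · exact Or.inr ⟨by linarith [hs.2], by linarith [hs.1]⟩
  · exact Or.inl ⟨by linarith [hs.2], by linarith [hs.1]⟩

theorem Flow.symm {t : ℝ} {x y : P} (h : Flow X t x y) : Flow X (-t) y x := by
  obtain ⟨c, hc, h0, ht⟩ := h
  refine ⟨fun s => c (t + s), (hc.comp_add t).mono fun s hs => ?_, by simpa using ht,
    by simpa using h0⟩
  rw [Set.mem_uIcc] at hs
  rw [Set.mem_preimage, Set.mem_uIcc]
  rcases hs with hs | hs
  · exact Or.inr ⟨by linarith [hs.1], by linarith [hs.2]⟩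
  · exact Or.inl ⟨by linarith [hs.1], by linarith [hs.2]⟩

theorem Flow.refl (X : Derivation ℝ (SmoothFun P) (SmoothFun P)) (x : P) : Flow X 0 x x := by
  refine ⟨fun _ => x, fun f t ht => ?_, rfl, rfl⟩
  rw [Set.uIcc_self] at ht ⊢
  rw [Set.mem_singleton_iff.1 ht]
  exact HasFDerivWithinAt.singleton

theorem Flow.eq [SubcartesianSpace P] {t : ℝ} {x y y' : P} (h : Flow X t x y)
    (h' : Flow X t x y') : y = y' := by
  wlog ht : 0 ≤ t generalizing X t
  · exact this h.neg h'.neg (by linarith)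
  obtain ⟨c, hc, rfl, rfl⟩ := h
  obtain ⟨c', hc', h0, rfl⟩ := h'
  rw [Set.uIcc_of_le ht] at hc hc'
  exact hc.eqOn_Icc hc' h0.symm (Set.right_mem_Icc.2 ht)

theorem Flow.symm' {t : ℝ} {x y : P} (h : Flow X (-t) x y) : Flow X t y x := by
  simpa using h.symm

theorem Flow.add_nonneg {s t : ℝ} (hs : 0 ≤ s) (ht : 0 ≤ t) {x y z : P} (h : Flow X s x y)
    (h' : Flow X t y z) : Flow X (s + t) x z := by
  obtain ⟨c, hc, rfl, rfl⟩ := h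
  obtain ⟨c', hc', h0, rfl⟩ := h'
  rw [Set.uIcc_of_le hs] at hc
  rw [Set.uIcc_of_le ht] at hc'
  let d : ℝ → P := fun u => if u ≤ s then c u else c' (-s + u)
  have hd : Set.EqOn d c (Set.Icc 0 s) := fun u hu => if_pos hu.2
  have hd' : Set.EqOn d (fun u => c' (-s + u)) (Set.Icc s (s + t)) := fun u hu => by
    rcases hu.1.eq_or_lt with rfl | hlt
    · simp [d, h0]
    · exact if_neg (not_le.2 hlt)
  have hc'' := (hc'.comp_add (-s)).mono (J := Set.Icc s (s + t)) fun u hu =>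
    ⟨by linarith [hu.1], by linarith [hu.2]⟩
  -- At times outside `J`, differentiability within `J` holds vacuously.
  have key : ∀ (e : ℝ → P) (J : Set ℝ), IsClosed J → Set.EqOn d e J → IsIntegralCurve X e J →
      ∀ (f : SmoothFun P) (u : ℝ),
        HasDerivWithinAt (fun r => f.1 (d r)) ((X f).1 (d u)) J u := by
    intro e J hJ hde he f u
    by_cases hu : u ∈ J
    · rw [hde hu]
      exact (he f u hu).congr (fun r hr => by rw [hde hr]) (by rw [hde hu])
    · exact HasFDerivWithinAt.of_notMem_closure (by rwa [hJ.closure_eq])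
  refine ⟨d, fun f u _ => ?_, hd ⟨le_rfl, hs⟩, ?_⟩
  · rw [Set.uIcc_of_le (by linarith), ← Set.Icc_union_Icc_eq_Icc hs (by linarith : s ≤ s + t)]
    exact (key c _ isClosed_Icc hd hc f u).union (key _ _ isClosed_Icc hd' hc'' f u)
  · rw [hd' ⟨by linarith, le_rfl⟩]
    simp

theorem Flow.exists_of_mem_uIcc {s t : ℝ} {x y : P} (h : Flow X t x y) (hs : s ∈ Set.uIcc 0 t) :
    ∃ z, Flow X s x z ∧ Flow X (t - s) z y := by
  obtain ⟨c, hc, rfl, rfl⟩ := h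
  refine ⟨c s, ⟨c, hc.mono (Set.uIcc_subset_uIcc_left hs), rfl, rfl⟩,
    fun r => c (s + r), (hc.comp_add s).mono fun r hr => ?_, by simp, by simp⟩
  rw [Set.mem_uIcc] at hr hs
  rw [Set.mem_preimage, Set.mem_uIcc]
  grind

/-- The group law of the flow, for arbitrary signs of the times. -/
theorem Flow.add [SubcartesianSpace P] {s t : ℝ} {x y z : P} (h : Flow X s x y)
    (h' : Flow X t y z) : Flow X (s + t) x z := by
  -- opposite signs, with the first time dominating
  have key : ∀ {X : Derivation ℝ (SmoothFun P) (SmoothFun P)} {s t : ℝ} {x y z : P},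
      0 ≤ s → t ≤ 0 → 0 ≤ s + t → Flow X s x y → Flow X t y z → Flow X (s + t) x z := by
    intro X s t x y z hs ht hst h h'
    obtain ⟨w, hw, hw'⟩ := h.exists_of_mem_uIcc (s := s + t)
      (by rw [Set.uIcc_of_le hs]; exact ⟨hst, by linarith⟩)
    rw [show s - (s + t) = -t by ring] at hw'
    rwa [h'.eq hw'.symm']
  wlog hs : 0 ≤ s generalizing X s t
  · have := (this (X := -X) h.neg h'.neg (by linarith)).neg
    rwa [show - -X = X from Derivation.ext fun f => neg_neg (X f),
      show -(-s + -t) = s + t by ring] at this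
  rcases le_total 0 t with ht | ht
  · exact h.add_nonneg hs ht h'
  rcases le_total 0 (s + t) with hst | hst
  · exact key hs ht hst h h'
  · have := key (s := -t) (t := -s) (by linarith) (by linarith) (by linarith) h'.symm h.symm
    rw [show -t + -s = -(s + t) by ring] at this
    exact this.symm'

/-- By uniqueness of integral curves, the value of `exp(tX)` does not depend on the curve chosen in
its definition. -/
theorem mem_exp_iff [SubcartesianSpace P] {t : ℝ} {x y : P} : y ∈ exp X t x ↔ Flow X t x y := by
  have key : ∀ h : (exp X t x).Dom, Flow X t x ((exp X t x).get h) := fun h =>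
    ⟨h.choose, h.choose_spec.1, h.choose_spec.2, rfl⟩
  constructor
  · rintro ⟨h, rfl⟩
    exact key h
  · intro h
    have hD : (exp X t x).Dom := by
      obtain ⟨c, hc, h0, -⟩ := h
      exact ⟨c, hc, h0⟩
    exact ⟨hD, (key hD).eq h⟩

theorem mem_multiExp_zero {X : Fin 0 → VectorField P} {t : Fin 0 → ℝ} {x y : P} :
    y ∈ multiExp X t x ↔ y = x := by
  simp [multiExp]

theorem mem_multiExp_succ [SubcartesianSpace P] {n : ℕ} {X : Fin (n + 1) → VectorField P}
    {t : Fin (n + 1) → ℝ} {x y : P} : y ∈ multiExp X t x ↔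
      ∃ z ∈ multiExp (Fin.tail X) (Fin.tail t) x, Flow (X 0).1 (t 0) z y :=
  Part.mem_bind_iff.trans (by simp only [mem_exp_iff])

theorem mem_orbit_iff [SubcartesianSpace P] {p y : P} : y ∈ orbit p ↔
    Relation.ReflTransGen (fun x y => ∃ (X : VectorField P) (t : ℝ), Flow X.1 t x y) p y := by
  constructor
  · rintro ⟨n, X, t, h⟩
    induction n generalizing y with
    | zero => rw [mem_multiExp_zero.1 h]
    | succ n ih =>
      obtain ⟨z, hz, hy⟩ := mem_multiExp_succ.1 h
      exact (ih _ _ hz).tail ⟨_, _, hy⟩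
  · intro h
    induction h with
    | refl => exact ⟨0, Fin.elim0, Fin.elim0, mem_multiExp_zero.2 rfl⟩
    | tail _ h ih =>
      obtain ⟨n, X, t, hz⟩ := ih
      obtain ⟨Y, s, hY⟩ := h
      exact ⟨n + 1, Fin.cons Y X, Fin.cons s t, mem_multiExp_succ.2 ⟨_, by simpa using hz,
        by simpa using hY⟩⟩

theorem mem_orbit_trans [SubcartesianSpace P] {p q y : P} (h : q ∈ orbit p) (h' : y ∈ orbit q) :
    y ∈ orbit p :=
  mem_orbit_iff.2 ((mem_orbit_iff.1 h).trans (mem_orbit_iff.1 h'))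

theorem mem_orbit_symm [SubcartesianSpace P] {p y : P} (h : y ∈ orbit p) : p ∈ orbit y := by
  have : Std.Symm fun x y : P => ∃ (X : VectorField P) (t : ℝ), Flow X.1 t x y :=
    ⟨fun _ _ ⟨X, t, hX⟩ => ⟨X, -t, hX.symm⟩⟩
  exact mem_orbit_iff.2 (Relation.ReflTransGen.stdSymm.symm _ _ (mem_orbit_iff.1 h))

end

/-! ### Local flows of vector fields and the chain rule -/

section

variable {P : Type*} [TopologicalSpace P] [DifferentialSpace P]
variable {X : Derivation ℝ (SmoothFun P) (SmoothFun P)}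

/-- `exp(tX)` is defined and smooth on an open neighbourhood `U` of `z`. Smoothness is encoded as:
smooth functions pull back to functions which, near each point of `U`, agree with elements of
`C^∞(P)`. No inverse is required, since `exp(-tX)` provides it. -/
def HasLocalFlow (X : Derivation ℝ (SmoothFun P) (SmoothFun P)) (t : ℝ) (z : P) : Prop :=
  ∃ (U : Set P) (Φ : P → P), IsOpen U ∧ z ∈ U ∧ ∀ y ∈ U, Flow X t y (Φ y) ∧
    ∀ f : SmoothFun P, ∃ g : SmoothFun P, (fun y => f.1 (Φ y)) =ᶠ[𝓝 y] g.1

theorem continuousAt_of_pullback {Φ : P → P} {y : P}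
    (h : ∀ f : SmoothFun P, ∃ g : SmoothFun P, (fun y => f.1 (Φ y)) =ᶠ[𝓝 y] g.1) :
    ContinuousAt Φ y := by
  refine tendsto_nhds_iff.2 fun f => ?_
  obtain ⟨g, hg⟩ := h f
  exact (continuous_smoothFun g).continuousAt.congr hg.symm

theorem IsVectorField.exists_hasLocalFlow [SubcartesianSpace P] (hX : IsVectorField X) (z : P) :
    ∃ U ∈ 𝓝 z, ∃ ε > 0, ∀ t : ℝ, |t| < ε → ∀ y ∈ U, HasLocalFlow X t y := by
  obtain ⟨U, hU, hz, ε, hε, h⟩ := hX z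
  refine ⟨U, hU.mem_nhds hz, ε, hε, fun t ht y hy => ?_⟩
  obtain ⟨Φ, hΦ, -, hΦs, -⟩ := h t ht
  exact ⟨U, Φ, hU, hy, fun y hy => ⟨mem_exp_iff.1 (hΦ y hy), fun f =>
    (hΦs f.1 f.2).exists_eventuallyEq hU hy⟩⟩

theorem HasLocalFlow.add [SubcartesianSpace P] {s t : ℝ} {z z₁ : P} (h : HasLocalFlow X s z)
    (hz : Flow X s z z₁) (h' : HasLocalFlow X t z₁) : HasLocalFlow X (s + t) z := by
  obtain ⟨U, Φ, hU, hzU, hΦ⟩ := h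
  obtain ⟨U', Φ', hU', hzU', hΦ'⟩ := h'
  have hc : ∀ y ∈ U, ContinuousAt Φ y := fun y hy => continuousAt_of_pullback (hΦ y hy).2
  refine ⟨U ∩ Φ ⁻¹' U', Φ' ∘ Φ,
    ContinuousOn.isOpen_inter_preimage (fun y hy => (hc y hy).continuousWithinAt) hU hU',
    ⟨hzU, ?_⟩, fun y hy => ⟨(hΦ y hy.1).1.add (hΦ' _ hy.2).1, fun f => ?_⟩⟩
  · rwa [Set.mem_preimage, (hΦ z hzU).1.eq hz]
  · obtain ⟨g', hg'⟩ := (hΦ' _ hy.2).2 f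
    obtain ⟨g, hg⟩ := (hΦ y hy.1).2 g'
    exact ⟨g, EventuallyEq.trans ((hc y hy.1).eventually hg') hg⟩

/-- The flow of a vector field is defined and smooth near any point where it is defined, however
long the time: the times along an integral curve for which this holds form an open and closed set,
by the group law. -/
theorem Flow.hasLocalFlow [SubcartesianSpace P] (hX : IsVectorField X) {t : ℝ} {z z' : P}
    (h : Flow X t z z') : HasLocalFlow X t z := by
  obtain ⟨c, hc, rfl, rfl⟩ := h
  have hflow : ∀ s ∈ Set.uIcc 0 t, Flow X s (c 0) (c s) := fun s hs =>
    ⟨c, hc.mono (Set.uIcc_subset_uIcc_left hs), rfl, rfl⟩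
  refine (isPreconnected_uIcc (a := 0) (b := t)).induction₂'
    (fun s s' => HasLocalFlow X s (c 0) → HasLocalFlow X s' (c 0)) (fun s hs => ?_)
    (fun _ _ _ _ _ _ h h' => h' ∘ h) Set.left_mem_uIcc Set.right_mem_uIcc ?_
  · obtain ⟨U, hU, ε, hε, hUε⟩ := hX.exists_hasLocalFlow (c s)
    filter_upwards [self_mem_nhdsWithin, hc.continuousOn s hs hU,
      mem_nhdsWithin_of_mem_nhds (Metric.ball_mem_nhds s hε)] with s' hs' hs'U hε'
    rw [Metric.mem_ball, Real.dist_eq] at hε'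
    constructor <;> intro h
    · simpa using h.add (hflow s hs) (hUε (s' - s) hε' _ (mem_of_mem_nhds hU))
    · rw [abs_sub_comm] at hε'
      simpa using h.add (hflow s' hs') (hUε (s - s') hε' _ hs'U)
  · obtain ⟨U, hU, ε, hε, hUε⟩ := hX.exists_hasLocalFlow (c 0)
    exact hUε 0 (by simpa) _ (mem_of_mem_nhds hU)

/-- Multiplication with a bump function turns the pullback by a local flow into a linear operator
on globally defined smooth functions. -/
theorem HasLocalFlow.exists_pullback {t : ℝ} {z : P} (h : HasLocalFlow X t z) :
    ∃ (Φ : P → P) (T : SmoothFun P →ₗ[ℝ] SmoothFun P), ∀ᶠ y in 𝓝 z, Flow X t y (Φ y) ∧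
      ∀ f : SmoothFun P, (fun y => f.1 (Φ y)) =ᶠ[𝓝 y] (T f).1 := by
  obtain ⟨U, Φ, hU, hz, hΦ⟩ := h
  obtain ⟨χ, h1, h0⟩ := exists_bump hU z hz
  have hmem : ∀ f : SmoothFun P, (fun y => χ.1 y * f.1 (Φ y)) ∈ smooth (P := P) := by
    intro f
    refine of_locally _ fun y => ?_
    by_cases hy : y ∈ U
    · obtain ⟨g, hg⟩ := (hΦ y hy).2 f
      obtain ⟨V, hVg, hV, hyV⟩ := mem_nhds_iff.1 hg
      exact ⟨V, hV, hyV, _, (χ * g).2, fun y' hy' => congrArg (χ.1 y' * ·) (hVg hy')⟩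
    · obtain ⟨V, hVχ, hV, hyV⟩ := mem_nhds_iff.1 (h0 y hy)
      refine ⟨V, hV, hyV, 0, zero_mem _, fun y' hy' => ?_⟩
      simp [show χ.1 y' = 0 from hVχ hy']
  refine ⟨Φ,
    { toFun := fun f => ⟨_, hmem f⟩
      map_add' := fun f g => Subtype.ext (funext fun y => mul_add _ _ _)
      map_smul' := fun r f => Subtype.ext (funext fun y => mul_left_comm _ _ _) }, ?_⟩
  filter_upwards [hU.mem_nhds hz, eventually_eventually_nhds.2 h1] with y hy hy1
  refine ⟨(hΦ y hy).1, fun f => ?_⟩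
  filter_upwards [hy1] with y' hy'
  simp [hy']

theorem exists_flow_subset_of_nonneg [SubcartesianSpace P]
    (X : Derivation ℝ (SmoothFun P) (SmoothFun P)) {z : P} {V : Set P} (hV : V ∈ 𝓝 z) :
    ∃ W ∈ 𝓝 z, ∃ δ > 0, ∀ y ∈ W, ∀ t : ℝ, 0 ≤ t → t < δ → ∀ y', Flow X t y y' → y' ∈ V := by
  obtain ⟨ι, _, ψ, hbasis, -, -⟩ := exists_coordinates z
  let X' : P → ι → ℝ := coordMap fun i => X (ψ i)
  set M := ‖X' z‖ + 1
  have hM : 0 < M := by positivity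
  have hVM : {y | y ∈ V ∧ ‖X' y‖ < M} ∈ 𝓝 z := by
    filter_upwards [hV, (continuous_coordMap fun i => X (ψ i)).norm.continuousAt.eventually_lt
      continuousAt_const (lt_add_one ‖X' z‖)] with y h1 h2
    exact ⟨h1, h2⟩
  obtain ⟨r, hr, hrV⟩ := hbasis _ hVM
  have hW : {y | ‖coordMap ψ y - coordMap ψ z‖ < r / 2} ∈ 𝓝 z := by
    refine ((continuous_coordMap ψ).sub continuous_const).norm.continuousAt.eventually_lt
      continuousAt_const ?_
    simpa using hr
  -- Curves starting within `r / 2` of `z` with speed less than `M` do not get further than `r`.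
  refine ⟨_, hW, r / (2 * M), by positivity, ?_⟩
  rintro _ hy t ht htδ _ ⟨c, hc, rfl, rfl⟩
  rw [Set.uIcc_of_le ht] at hc
  have hMt : M * t < r / 2 := by
    rw [lt_div_iff₀ (by positivity)] at htδ
    linarith
  have := image_norm_le_of_norm_deriv_right_lt_deriv_boundary
    (f := fun s => coordMap ψ (c s) - coordMap ψ z) (f' := fun s => X' (c s)) (a := 0) (b := t)
    (B := fun s => r / 2 + M * s) (B' := fun _ => M)
    (((continuous_coordMap ψ).comp_continuousOn hc.continuousOn).sub continuousOn_const)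
    (fun s hs => ((hc.hasDerivWithinAt_coordMap ψ (Set.Ico_subset_Icc_self hs)).sub_const
      _).mono_of_mem_nhdsWithin (Icc_mem_nhdsGE_of_mem_Ico hs))
    (by simpa using (show _ < r / 2 from hy).le)
    (fun s => by simpa using ((hasDerivAt_id s).const_mul M).const_add (r / 2))
    (fun s hs hseq => ?_) (Set.right_mem_Icc.2 ht)
  · exact (hrV (c t) (by linarith)).1
  · refine (hrV (c s) ?_).2
    rw [hseq]
    have := mul_le_mul_of_nonneg_left hs.2.le hM.le
    linarith

/-- The flow `(t, y) ↦ exp(tX)(y)` is continuous at `(0, z)`. -/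
theorem exists_flow_subset [SubcartesianSpace P]
    (X : Derivation ℝ (SmoothFun P) (SmoothFun P)) {z : P} {V : Set P} (hV : V ∈ 𝓝 z) :
    ∃ W ∈ 𝓝 z, ∃ δ > 0, ∀ y ∈ W, ∀ t : ℝ, |t| < δ → ∀ y', Flow X t y y' → y' ∈ V := by
  obtain ⟨W₁, hW₁, δ₁, hδ₁, h₁⟩ := exists_flow_subset_of_nonneg X hV
  obtain ⟨W₂, hW₂, δ₂, hδ₂, h₂⟩ := exists_flow_subset_of_nonneg (-X) hV
  refine ⟨_, inter_mem hW₁ hW₂, min δ₁ δ₂, lt_min hδ₁ hδ₂, fun y hy t ht y' h => ?_⟩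
  rw [lt_min_iff, abs_lt, abs_lt] at ht
  rcases le_total 0 t with h0 | h0
  · exact h₁ y hy.1 t h0 ht.1.2 y' h
  · exact h₂ y hy.2 (-t) (by linarith) (by linarith [ht.2.1]) y' h.neg

/-- The chain rule for `s ↦ exp(g(s)X)(b(s))`, where `b` is a curve with velocity `u` at `0` and
`T` is the pullback by the local flow at the fixed time `g(0)`. -/
theorem hasDerivAt_flow [SubcartesianSpace P] {g : ℝ → ℝ} {g' : ℝ} (hg : HasDerivAt g g' 0)
    {b h : ℝ → P} {Φ : P → P} {T : SmoothFun P → SmoothFun P}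
    (hΦ : ∀ᶠ y in 𝓝 (b 0), Flow X (g 0) y (Φ y) ∧
      ∀ f : SmoothFun P, (fun y => f.1 (Φ y)) =ᶠ[𝓝 y] (T f).1)
    {u : SmoothFun P → ℝ} (hu : ∀ f : SmoothFun P, HasDerivAt (fun s => f.1 (b s)) (u f) 0)
    (hh : ∀ᶠ s in 𝓝 0, Flow X (g s) (b s) (h s)) (f : SmoothFun P) :
    HasDerivAt (fun s => f.1 (h s)) (u (T f) + (X f).1 (h 0) * g') 0 := by
  have hb : ContinuousAt b 0 := tendsto_nhds_iff.2 fun f => (hu f).continuousAt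
  have hΦ0 := hΦ.self_of_nhds
  have hw0 : Φ (b 0) = h 0 := hΦ0.1.eq hh.self_of_nhds
  have hw : ContinuousAt (fun s => Φ (b s)) 0 :=
    ContinuousAt.comp (g := Φ) (continuousAt_of_pullback fun f => ⟨T f, hΦ0.2 f⟩) hb
  have hflow : ∀ᶠ s in 𝓝 0, Flow X (g s - g 0) (Φ (b s)) (h s) := by
    filter_upwards [hb.eventually hΦ, hh] with s h1 h2
    have := h1.1.symm.add h2
    rwa [neg_add_eq_sub] at this
  have hlin : HasDerivAt (fun s => (X f).1 (h 0) * (g s - g 0)) ((X f).1 (h 0) * g') 0 :=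
    (hg.sub_const _).const_mul _
  -- By the mean value inequality along the integral curve from `Φ (b s)` to `h s`.
  have hrem : (fun s => f.1 (h s) - f.1 (Φ (b s)) - (X f).1 (h 0) * (g s - g 0)) =o[𝓝 0]
      fun s => g s - g 0 := by
    refine Asymptotics.isLittleO_iff.2 fun ε hε => ?_
    have hV : {y | ‖(X f).1 y - (X f).1 (h 0)‖ < ε} ∈ 𝓝 (Φ (b 0)) := by
      refine ((continuous_smoothFun (X f)).sub continuous_const).norm.continuousAt.eventually_lt
        continuousAt_const ?_
      simpa [hw0] using hε
    obtain ⟨W, hW, δ, hδ, hWδ⟩ := exists_flow_subset X hV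
    filter_upwards [hflow, hw hW, hg.continuousAt (Metric.ball_mem_nhds _ hδ)] with s h1 h2 h3
    rw [Set.mem_preimage, Metric.mem_ball, Real.dist_eq] at h3
    obtain ⟨c, hc, hc0, hct⟩ := h1
    have := Convex.norm_image_sub_le_of_norm_hasDerivWithin_le (C := ε)
      (f := fun r => f.1 (c r) - (X f).1 (h 0) * r)
      (f' := fun r => (X f).1 (c r) - (X f).1 (h 0)) (s := Set.uIcc 0 (g s - g 0))
      (fun r hr => ((hc f r hr).sub ((hasDerivWithinAt_id r _).const_mul
        ((X f).1 (h 0)))).congr_deriv (by rw [mul_one]))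
      (fun r hr => (hWδ _ h2 r
        ((by simpa using Set.abs_sub_left_of_mem_uIcc hr : |r| ≤ _).trans_lt h3) (c r)
        ⟨c, hc.mono (Set.uIcc_subset_uIcc_left hr), hc0, rfl⟩).le)
      (convex_uIcc 0 (g s - g 0)) Set.left_mem_uIcc Set.right_mem_uIcc
    simpa only [hc0, hct, mul_zero, sub_zero, sub_right_comm] using this
  have hrem' : HasDerivAt (fun s => f.1 (h s) - f.1 (Φ (b s)) - (X f).1 (h 0) * (g s - g 0))
      0 0 := by
    rw [hasDerivAt_iff_isLittleO]
    simpa [hw0] using hrem.trans_isBigO hg.isBigO_sub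
  have hTf : HasDerivAt (fun s => f.1 (Φ (b s))) (u (T f)) 0 :=
    (hu (T f)).congr_of_eventuallyEq (hb.eventually (hΦ0.2 f))
  refine (((hrem'.add hlin).add hTf).congr_deriv (by ring)).congr_of_eventuallyEq
    (Eventually.of_forall fun s => ?_)
  simp

end

/-! ### Continuous extension of velocities -/

section

variable {P : Type*} [TopologicalSpace P] [DifferentialSpace P]

/-- The span of the velocities at `y` of those curves through `y` which are of the form
`s ↦ (exp(t₁X₁) ∘ ⋯ ∘ exp(tₙXₙ))(q)` near `s = 0`, with times `tᵢ` depending smoothly on `s`. -/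
def flowVelocities (y : P) : Submodule ℝ (Module.Dual ℝ (SmoothFun P)) :=
  Submodule.span ℝ {v | ∃ γ : ℝ → P, γ 0 = y ∧
    (∃ (n : ℕ) (X : Fin n → VectorField P) (q : P) (g : ℝ → Fin n → ℝ), ContDiff ℝ ∞ g ∧
      ∀ᶠ s in 𝓝 0, γ s ∈ multiExp X (g s) q) ∧
    ∀ f : SmoothFun P, HasDerivAt (fun s => f.1 (γ s)) (v f) 0}

/-- The functionals `u` on `C^∞(P)` which extend to a local section `V` of the family of spaces
`flowVelocities` around `z`, continuous in the sense that `y ↦ V y f` is continuous at `z` for each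
smooth function `f`. -/
def extendableVelocities (z : P) : Submodule ℝ (Module.Dual ℝ (SmoothFun P)) where
  carrier := {u | ∃ V : P → Module.Dual ℝ (SmoothFun P), V z = u ∧
    (∀ f, ContinuousAt (fun y => V y f) z) ∧ ∀ᶠ y in 𝓝 z, V y ∈ flowVelocities y}
  add_mem' := by
    rintro _ _ ⟨V, rfl, hc, hV⟩ ⟨V', rfl, hc', hV'⟩
    exact ⟨fun y => V y + V' y, rfl, fun f => (hc f).add (hc' f),
      (hV.and hV').mono fun y h => add_mem h.1 h.2⟩
  zero_mem' := ⟨0, rfl, fun f => continuousAt_const, Eventually.of_forall fun y => zero_mem _⟩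
  smul_mem' := by
    rintro r _ ⟨V, rfl, hc, hV⟩
    exact ⟨fun y => r • V y, rfl, fun f => (hc f).const_smul r,
      hV.mono fun y h => Submodule.smul_mem _ r h⟩

/-- The value at `y` of a derivation of `C^∞(P)`. -/
def valueAt (X : Derivation ℝ (SmoothFun P) (SmoothFun P)) (y : P) :
    Module.Dual ℝ (SmoothFun P) where
  toFun f := (X f).1 y
  map_add' f g := by simp
  map_smul' r f := by simp

theorem valueAt_mem_flowVelocities [SubcartesianSpace P] (X : VectorField P) (y : P) :
    valueAt X.1 y ∈ flowVelocities y := by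
  obtain ⟨U, hU, ε, hε, hUε⟩ := X.2.exists_hasLocalFlow y
  have hex : ∀ s : ℝ, ∃ y', |s| < ε → Flow X.1 s y y' := fun s => by
    by_cases hs : |s| < ε
    · obtain ⟨U', Φ, -, hy, hΦ⟩ := hUε s hs y (mem_of_mem_nhds hU)
      exact ⟨Φ y, fun _ => (hΦ y hy).1⟩
    · exact ⟨y, fun h => (hs h).elim⟩
  choose γ hγ using hex
  have hflow : ∀ᶠ s in 𝓝 0, Flow X.1 s y (γ s) := by
    filter_upwards [Metric.ball_mem_nhds (0 : ℝ) hε] with s hs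
    exact hγ s (by simpa using hs)
  have h0 : γ 0 = y := hflow.self_of_nhds.eq (Flow.refl _ y)
  refine Submodule.subset_span ⟨γ, h0, ⟨1, fun _ => X, y, fun s _ => s,
    contDiff_pi.2 fun _ => contDiff_id, ?_⟩, fun f => ?_⟩
  · filter_upwards [hflow] with s hs
    exact mem_multiExp_succ.2 ⟨y, mem_multiExp_zero.2 rfl, hs⟩
  -- The derivative comes from the chain rule for the constant curve at `y`.
  · refine (hasDerivAt_flow (X := X.1) (hasDerivAt_id (0 : ℝ)) (b := fun _ => y) (Φ := id)
      (T := id) (u := 0) (Eventually.of_forall fun y => ⟨Flow.refl _ y, fun f => EventuallyEq.rfl⟩)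
      (fun f => hasDerivAt_const _ _) hflow f).congr_deriv ?_
    simp [valueAt, h0]

theorem valueAt_mem_extendableVelocities [SubcartesianSpace P] (X : VectorField P) (z : P) :
    valueAt X.1 z ∈ extendableVelocities z :=
  ⟨valueAt X.1, rfl, fun f => (continuous_smoothFun (X.1 f)).continuousAt,
    Eventually.of_forall (valueAt_mem_flowVelocities X)⟩

/-- Local flows of vector fields push velocities forward to velocities. -/
theorem comp_pullback_mem_flowVelocities [SubcartesianSpace P] {X : VectorField P} {t : ℝ}
    {Φ : P → P} {T : SmoothFun P →ₗ[ℝ] SmoothFun P} {y : P}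
    (hΦ : ∀ᶠ y' in 𝓝 y, Flow X.1 t y' (Φ y') ∧
      ∀ f : SmoothFun P, (fun y => f.1 (Φ y)) =ᶠ[𝓝 y'] (T f).1)
    {v : Module.Dual ℝ (SmoothFun P)} (hv : v ∈ flowVelocities y) :
    v ∘ₗ T ∈ flowVelocities (Φ y) := by
  refine (Submodule.span_le (p := (flowVelocities (Φ y)).comap (LinearMap.lcomp ℝ ℝ T))).2 ?_ hv
  rintro w ⟨γ, rfl, ⟨n, Xs, q, g, hg, hγ⟩, hw⟩
  have hc : ContinuousAt γ 0 := tendsto_nhds_iff.2 fun f => (hw f).continuousAt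
  refine Submodule.subset_span ⟨fun s => Φ (γ s), rfl, ⟨n + 1, Fin.cons X Xs, q,
    fun s => Fin.cons t (g s), contDiff_pi.2 fun i => ?_, ?_⟩, fun f => ?_⟩
  · refine Fin.cases ?_ (fun j => ?_) i
    · exact contDiff_const
    · exact contDiff_pi.1 hg j
  · filter_upwards [hγ, hc.eventually hΦ] with s h1 h2
    exact mem_multiExp_succ.2 ⟨γ s, by simpa using h1, by simpa using h2.1⟩
  · exact (hw (T f)).congr_of_eventuallyEq (hc.eventually (hΦ.self_of_nhds.2 f))

/-- Local flows of vector fields push extendable velocities forward to extendable velocities: the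
local section is pushed forward along with its value, its base points being transported back by
`exp(-tX)`. -/
theorem comp_pullback_mem_extendableVelocities [SubcartesianSpace P] {X : VectorField P} {t : ℝ}
    {Φ : P → P} {T : SmoothFun P →ₗ[ℝ] SmoothFun P} {z : P}
    (hΦ : ∀ᶠ y in 𝓝 z, Flow X.1 t y (Φ y) ∧
      ∀ f : SmoothFun P, (fun y => f.1 (Φ y)) =ᶠ[𝓝 y] (T f).1)
    {u : Module.Dual ℝ (SmoothFun P)} (hu : u ∈ extendableVelocities z) :
    u ∘ₗ T ∈ extendableVelocities (Φ z) := by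
  obtain ⟨V, rfl, hVc, hV⟩ := hu
  have hz := hΦ.self_of_nhds.1
  obtain ⟨Ψ, S, hΨ⟩ := (hz.symm.hasLocalFlow X.2).exists_pullback
  have hΨz : Ψ (Φ z) = z := hΨ.self_of_nhds.1.eq hz.symm
  have hΨc : Tendsto Ψ (𝓝 (Φ z)) (𝓝 z) := by
    have := continuousAt_of_pullback fun f => ⟨S f, hΨ.self_of_nhds.2 f⟩
    rwa [ContinuousAt, hΨz] at this
  refine ⟨fun y => V (Ψ y) ∘ₗ T, by simp only [hΨz], fun f => ?_, ?_⟩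
  · have := (hVc (T f)).tendsto.comp hΨc
    simp only [ContinuousAt, hΨz]
    exact this
  · filter_upwards [hΨ, hΨc.eventually (eventually_eventually_nhds.2 hΦ),
      hΨc.eventually hV] with y h1 h2 h3
    have hy : Φ (Ψ y) = y := h2.self_of_nhds.1.eq h1.1.symm'
    simpa only [hy] using comp_pullback_mem_flowVelocities h2 h3

/-- A curve `s ↦ (exp(t₁X₁) ∘ ⋯ ∘ exp(tₙXₙ))(q)` with differentiable times `tᵢ` has a velocity, which
is a linear combination of push-forwards of the vectors `Xᵢ` by local flows; as such it extends to
a continuous section. -/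
theorem exists_extendableVelocity [SubcartesianSpace P] {n : ℕ} {X : Fin n → VectorField P} {q : P}
    {g : ℝ → Fin n → ℝ} (hg : DifferentiableAt ℝ g 0) {b : ℝ → P}
    (hb : ∀ᶠ s in 𝓝 0, b s ∈ multiExp X (g s) q) :
    ∃ u ∈ extendableVelocities (b 0),
      ∀ f : SmoothFun P, HasDerivAt (fun s => f.1 (b s)) (u f) 0 := by
  induction n generalizing b with
  | zero =>
    refine ⟨0, zero_mem _, fun f => ?_⟩
    refine (hasDerivAt_const (0 : ℝ) (f.1 q)).congr_of_eventuallyEq ?_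
    filter_upwards [hb] with s hs
    rw [mem_multiExp_zero.1 hs]
  | succ n ih =>
    have hex : ∀ s, ∃ z, b s ∈ multiExp X (g s) q →
        z ∈ multiExp (Fin.tail X) (Fin.tail (g s)) q ∧ Flow (X 0).1 (g s 0) z (b s) := fun s => by
      by_cases hs : b s ∈ multiExp X (g s) q
      · obtain ⟨z, hz⟩ := mem_multiExp_succ.1 hs
        exact ⟨z, fun _ => hz⟩
      · exact ⟨q, fun h => (hs h).elim⟩
    choose a ha using hex
    rw [differentiableAt_pi] at hg
    obtain ⟨u, hu, hd⟩ := ih (X := Fin.tail X) (g := fun s => Fin.tail (g s)) (b := a)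
      (differentiableAt_pi.2 fun i => hg i.succ) (hb.mono fun s hs => (ha s hs).1)
    have hflow : ∀ᶠ s in 𝓝 0, Flow (X 0).1 (g s 0) (a s) (b s) := hb.mono fun s hs => (ha s hs).2
    obtain ⟨Φ, T, hΦ⟩ := (hflow.self_of_nhds.hasLocalFlow (X 0).2).exists_pullback
    have hΦb : Φ (a 0) = b 0 := hΦ.self_of_nhds.1.eq hflow.self_of_nhds
    refine ⟨u ∘ₗ T + deriv (fun s => g s 0) 0 • valueAt (X 0).1 (b 0), add_mem
      (hΦb ▸ comp_pullback_mem_extendableVelocities hΦ hu)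
      (Submodule.smul_mem _ _ (valueAt_mem_extendableVelocities _ _)), fun f => ?_⟩
    refine (hasDerivAt_flow (g := fun s => g s 0) (hg 0).hasDerivAt hΦ hd hflow f).congr_deriv ?_
    simp [valueAt, mul_comm]

/-- Elements of `flowVelocities y` are derivations at `y`. -/
theorem flowVelocities_le_tangentSpace (y : P) : flowVelocities y ≤ tangentSpace y := by
  refine Submodule.span_le.2 ?_
  rintro v ⟨γ, rfl, -, hv⟩ f g
  refine (hv (f * g)).unique (((hv f).mul (hv g)).congr_deriv ?_)
  ring

/-- Elements of `flowVelocities y` depend only on germs at `y`. -/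
theorem eq_of_mem_flowVelocities {y : P} {v : Module.Dual ℝ (SmoothFun P)}
    (hv : v ∈ flowVelocities y) {f g : SmoothFun P} (h : f.1 =ᶠ[𝓝 y] g.1) : v f = v g := by
  suffices hker : v ∈ LinearMap.ker (Module.Dual.eval ℝ _ (f - g)) from
    sub_eq_zero.1 ((map_sub v f g).symm.trans hker)
  refine Submodule.span_le.2 ?_ hv
  rintro v ⟨γ, rfl, -, hv⟩
  have hc : ContinuousAt γ 0 := tendsto_nhds_iff.2 fun f => (hv f).continuousAt
  refine (hv (f - g)).unique ((hasDerivAt_const (0 : ℝ) (0 : ℝ)).congr_of_eventuallyEq ?_)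
  filter_upwards [hc.eventually h] with s hs
  exact sub_eq_zero.2 hs

end

/-! ### The tangent spaces of orbits -/

section

variable {P : Type*} [TopologicalSpace P] [DifferentialSpace P]

/-- Plots of the orbit diffeology are locally of the form
`s ↦ (exp(t₁X₁) ∘ ⋯ ∘ exp(tₙXₙ))(q)`: maps with this property form a diffeology which contains the
generating plots. -/
theorem exists_multiExp_of_isPlot {p : P} {k : ℕ} {c : EuclideanSpace ℝ (Fin k) → orbit p}
    (hc : Diffeology.IsPlot c) (x : EuclideanSpace ℝ (Fin k)) :
    ∃ (n : ℕ) (X : Fin n → VectorField P) (q : P) (g : EuclideanSpace ℝ (Fin k) → Fin n → ℝ),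
      ContDiffAt ℝ ∞ g x ∧ ∀ᶠ s in 𝓝 x, (c s : P) ∈ multiExp X (g s) q := by
  let d : DiffeologicalSpace (orbit p) :=
    { plots := fun k => {c | ∀ x, ∃ (n : ℕ) (X : Fin n → VectorField P) (q : P)
        (g : EuclideanSpace ℝ (Fin k) → Fin n → ℝ),
        ContDiffAt ℝ ∞ g x ∧ ∀ᶠ s in 𝓝 x, (c s : P) ∈ multiExp X (g s) q}
      constant_plots := fun y x => ⟨0, Fin.elim0, y, fun _ => Fin.elim0,
        contDiffAt_const, Eventually.of_forall fun _ => mem_multiExp_zero.2 rfl⟩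
      plot_reparam := fun {k m c f} hc hf x => by
        obtain ⟨n, X, q, g, hg, h⟩ := hc (f x)
        exact ⟨n, X, q, g ∘ f, hg.comp x hf.contDiffAt, hf.continuous.continuousAt.eventually h⟩
      locality := fun {k c} hc x => by
        obtain ⟨u, hu, hxu, h⟩ := hc x
        obtain ⟨ε, hε, hεu⟩ := Metric.isOpen_iff.1 hu x hxu
        let e := OpenPartialHomeomorph.univBall x ε
        have het : e.target = Metric.ball x ε := OpenPartialHomeomorph.univBall_target x hε
        have hball : Metric.ball x ε ∈ 𝓝 x := Metric.ball_mem_nhds x hε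
        have hes : e.symm x = 0 := OpenPartialHomeomorph.univBall_symm_apply_center x ε
        have hsm : ContDiffAt ℝ ∞ e.symm x :=
          OpenPartialHomeomorph.contDiffOn_univBall_symm.contDiffAt hball
        obtain ⟨n, X, q, g, hg, hgs⟩ := h (f := e)
          (fun y => hεu (het ▸ e.map_source
            (by rw [OpenPartialHomeomorph.univBall_source]; trivial)))
          OpenPartialHomeomorph.contDiff_univBall (e.symm x)
        refine ⟨n, X, q, g ∘ e.symm, hg.comp x hsm, ?_⟩
        filter_upwards [hball, hsm.continuousAt.eventually hgs] with y hy h'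
        rwa [Function.comp_apply, e.right_inv (het ▸ hy)] at h' }
  refine hc d ?_ x
  rintro ⟨k, c⟩ ⟨n, X, y, g, hg, h⟩ x
  exact ⟨n, X, y, g, hg.contDiffAt, Eventually.of_forall h⟩

theorem mem_extendableVelocities_of_mem_orbitTangentSpace [SubcartesianSpace P] {p : P}
    {x : orbit p} {u : tangentSpace (x : P)} (hu : u ∈ orbitTangentSpace p x) :
    u.1 ∈ extendableVelocities (x : P) := by
  refine (Submodule.span_le (p := (extendableVelocities (x : P)).comap
    (tangentSpace (x : P)).subtype)).2 ?_ hu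
  rintro u ⟨c, hc, rfl, hcu⟩
  have hplot : Diffeology.IsPlot fun v : EuclideanSpace ℝ (Fin 1) => c (v 0) :=
    hc 1 (fun v => v 0) (ContDiff.isPlot (EuclideanSpace.proj (𝕜 := ℝ) (0 : Fin 1)).contDiff)
  let l : ℝ → EuclideanSpace ℝ (Fin 1) := fun s => WithLp.toLp 2 fun _ => s
  have hl : ContDiff ℝ ∞ l :=
    (PiLp.contDiff_toLp (p := 2)).comp (contDiff_pi.2 fun _ => contDiff_id)
  obtain ⟨n, X, q, g, hg, hgs⟩ := exists_multiExp_of_isPlot hplot (l 0)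
  obtain ⟨w, hw, hcw⟩ := exists_extendableVelocity (g := g ∘ l) (b := fun s => (c s : P))
    ((hg.differentiableAt (by simp)).comp (0 : ℝ) (hl.differentiable (by simp) 0))
    (hl.continuous.continuousAt.eventually hgs)
  rwa [show w = u.1 from LinearMap.ext fun f => (hcw f).unique (hcu f)] at hw

/-- At the points of an orbit, `flowVelocities` consists of vectors tangent to the orbit. A curve
given only near time `0` is reparametrized by `s ↦ (ε / 2) * sin (2 * s / ε)`. -/
theorem exists_mem_orbitTangentSpace [SubcartesianSpace P] {p : P} {x : orbit p}
    {v : Module.Dual ℝ (SmoothFun P)} (hv : v ∈ flowVelocities (x : P)) :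
    ∃ u ∈ orbitTangentSpace p x, u.1 = v := by
  refine (Submodule.span_le (p := (orbitTangentSpace p x).map
    (tangentSpace (x : P)).subtype)).2 ?_ hv
  rintro v ⟨γ, h0, ⟨n, X, q, g, hg, hgs⟩, hγv⟩
  have hv' : v ∈ tangentSpace (x : P) := flowVelocities_le_tangentSpace _
    (Submodule.subset_span ⟨γ, h0, ⟨n, X, q, g, hg, hgs⟩, hγv⟩)
  refine ⟨⟨v, hv'⟩, Submodule.subset_span ?_, rfl⟩
  obtain ⟨ε, hε, hεs⟩ := Metric.eventually_nhds_iff_ball.1 hgs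
  let η : ℝ → ℝ := fun s => ε / 2 * Real.sin (2 / ε * s)
  have hη : ContDiff ℝ ∞ η := contDiff_const.mul
    (Real.contDiff_sin.comp (contDiff_const.mul contDiff_id))
  have hηε : ∀ s, η s ∈ Metric.ball 0 ε := fun s => by
    rw [mem_ball_zero_iff, Real.norm_eq_abs, abs_mul, abs_of_pos (by positivity)]
    nlinarith [Real.abs_sin_le_one (2 / ε * s)]
  have hη0 : η 0 = 0 := by simp [η]
  have hηd : HasDerivAt η 1 0 := by
    refine ((((hasDerivAt_id (0 : ℝ)).const_mul (2 / ε)).sin).const_mul (ε / 2)).congr_deriv ?_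
    simp
    field_simp
  have hq : q ∈ orbit p := by
    refine mem_orbit_trans x.2 (mem_orbit_symm ⟨n, X, g 0, ?_⟩)
    rw [← h0]
    exact hgs.self_of_nhds
  have horb : ∀ s, γ (η s) ∈ orbit p := fun s => mem_orbit_trans hq ⟨n, X, _, hεs _ (hηε s)⟩
  refine ⟨fun s => ⟨γ (η s), horb s⟩, fun k r hr => ?_, Subtype.ext (by simp only [hη0, h0]),
    fun f => ?_⟩
  · exact DiffeologicalSpace.isPlot_generatedFrom_of_mem
      ⟨n, X, ⟨q, hq⟩, g ∘ η ∘ r, hg.comp (hη.comp hr.contDiff), fun s => hεs _ (hηε (r s))⟩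
  · have hf : HasDerivAt (fun s => f.1 (γ s)) (v f) (η 0) := by simpa only [hη0] using hγv f
    exact (hf.comp 0 hηd).congr_deriv (mul_one _)

end

end DifferentialSpace

open DifferentialSpace

theorem mainTheorem3 {P : Type*} [TopologicalSpace P] [DifferentialSpace P] [SubcartesianSpace P]
    (p p' : P) (x : ℕ → DifferentialSpace.orbit p) (x' : DifferentialSpace.orbit p')
    (hx : Filter.Tendsto (fun n => (x n : P)) Filter.atTop (nhds (x' : P)))
    {N : ℕ} (U : Set P) (φ : P → EuclideanSpace ℝ (Fin N))
    (hφ : DifferentialSpace.IsLocalChart U φ) (hU : (x' : P) ∈ U)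
    (D : Submodule ℝ (EuclideanSpace ℝ (Fin N)))
    (hD : DifferentialSpace.GrassmannTendsto
      (fun n => DifferentialSpace.chartImage φ (x n : P)
        (DifferentialSpace.orbitTangentSpace p (x n))) D) :
    DifferentialSpace.chartImage φ (x' : P) (DifferentialSpace.orbitTangentSpace p' x') ≤ D := by
  rintro w ⟨u, hu, hw⟩
  obtain ⟨V, hVu, hVc, hV⟩ := mem_extendableVelocities_of_mem_orbitTangentSpace hu
  choose φ' hφ' using fun i => hφ.exists_component hU i
  let v : ℕ → EuclideanSpace ℝ (Fin N) := fun n => WithLp.toLp 2 fun i => V (x n) (φ' i)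
  have hvw : Tendsto v atTop (𝓝 w) := by
    have : w = WithLp.toLp 2 fun i => V x' (φ' i) := by
      ext i
      exact (hw i (φ' i) (hφ' i).symm).trans (by rw [hVu])
    rw [this]
    exact ((PiLp.continuous_toLp 2 _).tendsto _).comp
      (tendsto_pi_nhds.2 fun i => (hVc (φ' i)).tendsto.comp hx)
  have hvT : ∀ᶠ n in atTop, v n ∈ chartImage φ (x n : P) (orbitTangentSpace p (x n)) := by
    filter_upwards [hx.eventually hV,
      hx.eventually (eventually_all.2 fun i => eventually_eventually_nhds.2 (hφ' i))] with n h1 h2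
    obtain ⟨u', hu', huV⟩ := exists_mem_orbitTangentSpace h1
    refine ⟨u', hu', fun i g hg => ?_⟩
    rw [huV]
    exact eq_of_mem_flowVelocities h1 (EventuallyEq.trans (EventuallyEq.symm (h2 i)) hg.symm)
  -- `v n` is fixed by the projection to `T_{x_n} O`, hence its limit by the projection to `D`.
  have hlim : Tendsto v atTop (𝓝 (D.starProjection w)) := by
    refine ((isBoundedBilinearMap_apply.continuous.tendsto (D.starProjection, w)).comp
      (Tendsto.prodMk_nhds hD hvw)).congr' ?_
    filter_upwards [hvT] with n hn
    exact Submodule.starProjection_eq_self_iff.2 hn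
  exact Submodule.starProjection_eq_self_iff.1 (tendsto_nhds_unique hlim hvw)
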